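/- All graphs are undirected, without loops or multiple edges, and "countable" means finite or countably infinite. Let $R$ be the countable universal graph, that is, the Fra\"iss\'e limit of the class of finite graphs (the random graph): the countable graph, unique up to isomorphism, that contains every finite graph as an induced subgraph and in which every isomorphism between finite induced subgraphs extends to an automorphism. Let $M=\operatorname{End} R$ be the monoid of all graph homomorphisms $R\to R$ under composition. For $f,g\in M$ write $f\,\mathscr{L}\,g$ if $Mf=Mg$, $f\,\mathscr{R}\,g$ if $fM=gM$, and put $\mathscr{H}=\mathscr{L}\cap\mathscr{R}$, $\mathscr{D}=\mathscr{L}\circ\mathscr{R}$; these are equivalence relations. A $\mathscr{D}$-class is regular if it is the $\mathscr{D}$-class of an element $f$ with $fgf=f$ for some $g\in M$. A group $\mathscr{H}$-class is an $\mathscr{H}$-class that forms a group under the multiplication of $M$. **Theorem.** 1. Let $\Gamma$ be any countable graph. Then there are exactly $2^{\aleph_0}$ distinct regular $\mathscr{D}$-classes of $\operatorname{End} R$ that contain a group $\mathscr{H}$-class and all of whose group $\mathscr{H}$-classes are isomorphic to $\operatorname{Aut}\Gamma$. 2. Every regular $\mathscr{D}$-class of $\operatorname{End} R$ contains exactly $2^{\aleph_0}$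 distinct group $\mathscr{H}$-classes. -/

import Mathlib

/-- A graph is (a copy of) the countable universal graph, that is, the Fraïssé limit of the class of
finite graphs: it is countable, every finite graph embeds in it as an induced subgraph, and
every embedding of a finite induced subgraph extends to an automorphism. -/
structure IsCountableUniversalGraph {W : Type*} (R : SimpleGraph W) : Prop where
  countable : Countable W
  universal : ∀ (n : ℕ) (F : SimpleGraph (Fin n)), Nonempty (F ↪g R)
  homogeneous : ∀ (A : Set W), A.Finite → ∀ φ : R.induce A ↪g R,
    ∃ α : R ≃g R, ∀ a : A, α (a : W) = φ a

namespace Green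

variable {M : Type*} [Monoid M]

/-- Green's relation `L`: the two elements generate the same left ideal, `M a = M b`. -/
def RelL (a b : M) : Prop :=
  Set.range (fun m : M => m * a) = Set.range (fun m : M => m * b)

/-- Green's relation `R`: the two elements generate the same right ideal, `a M = b M`. -/
def RelR (a b : M) : Prop :=
  Set.range (fun m : M => a * m) = Set.range (fun m : M => b * m)

/-- Green's relation `H`, the intersection of `L` and `R`. -/
def RelH (a b : M) : Prop := RelL a b ∧ RelR a b

/-- Green's relation `D`, the composite `L ∘ R`. -/
def RelD (a b : M) : Prop := ∃ c : M, RelL a c ∧ RelR c b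

/-- Von Neumann regular elements of a monoid. -/
def IsRegularElement (a : M) : Prop := ∃ b : M, a * b * a = a

/-- A regular `D`-class: the `D`-class of a regular element. -/
def IsRegularDClass (D : Set M) : Prop :=
  ∃ a : M, IsRegularElement a ∧ D = {b | RelD a b}

/-- `H` is an `H`-class. -/
def IsHClass (H : Set M) : Prop := ∃ a : M, H = {b | RelH a b}

/-- `H` is an `H`-class that is a group under the multiplication inherited from `M`
(its identity element need not be that of `M`). -/
def IsGroupHClass (H : Set M) : Prop :=
  IsHClass H ∧ ∃ S : Subsemigroup M, (S : Set M) = H ∧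
    ∃ e : S, (∀ a : S, e * a = a ∧ a * e = a) ∧ ∀ a : S, ∃ b : S, a * b = e ∧ b * a = e

/-- The subset `H` of `M` is closed under multiplication and, with the inherited multiplication,
is isomorphic to the group `G`. -/
def IsIsomorphicTo (H : Set M) (G : Type*) [Group G] : Prop :=
  ∃ S : Subsemigroup M, (S : Set M) = H ∧ Nonempty (S ≃* G)

end Green

/-! An idempotent of `End R` is a retraction `s ∘ r` onto a graph `D`, where `r ∘ s = id`. Its
H-class is a group isomorphic to `Aut D` (`relH_retract`), and two idempotents are D-related exactly
when their retracts are isomorphic (`nonempty_iso_of_relD`, `relD_of_iso`). A countable graph is a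
retract of `R` exactly when its finite vertex sets have common neighbours
(`IsAlgebraicallyClosed.of_retract`, `IsAlgebraicallyClosed.exists_hom_factor`).

For the first claim, form the disjoint union of `Γ` with a rigid connected graph coding a set `S ⊆
ℕ`, and take the complement. The complement is algebraically closed. For all but countably many `S`
the coded graph is not already a component of `Γ`, so the automorphism group is still `Aut Γ` and
`S` can be recovered from the isomorphism type.

For the second claim, replace each vertex of a retract `D` by two nonadjacent twins and embed the
result in `R` so that the projection to `D` extends to `R`. Choosing one twin over each vertex gives
continuum many idempotents, all with retract `D`, and distinct idempotents lie in distinct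
H-classes. The upper bounds hold because `End R` has at most continuum many elements. -/

namespace SimpleGraph

/-! ### Extension properties and back-and-forth -/

/-- Every finite set of vertices has a common neighbour. -/
def IsAlgebraicallyClosed {V : Type*} (G : SimpleGraph V) : Prop :=
  ∀ A : Finset V, ∃ v, ∀ a ∈ A, G.Adj v a

/-- Alice's restaurant property: for disjoint finite sets `A` and `B` there is a vertex outside
`B` that is adjacent to everything in `A` and to nothing in `B`. -/
def HasExtensionProperty {V : Type*} (G : SimpleGraph V) : Prop :=
  ∀ A B : Finset V, Disjoint A B → ∃ v, v ∉ B ∧ (∀ a ∈ A, G.Adj v a) ∧ ∀ b ∈ B, ¬ G.Adj v b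

/-- Finite partial isomorphisms between two graphs, as finite sets of pairs. -/
def FinitePartialIso {V W : Type*} (G : SimpleGraph V) (H : SimpleGraph W) : Type _ :=
  {f : Finset (V × W) // ∀ p ∈ f, ∀ q ∈ f,
    (p.1 = q.1 ↔ p.2 = q.2) ∧ (G.Adj p.1 q.1 ↔ H.Adj p.2 q.2)}

namespace FinitePartialIso

variable {V W : Type*} {G : SimpleGraph V} {H : SimpleGraph W}

instance : Preorder (FinitePartialIso G H) := Preorder.lift Subtype.val

theorem exists_extend_left (hH : H.HasExtensionProperty) (f : FinitePartialIso G H) (a : V) :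
    ∃ g : FinitePartialIso G H, (∃ b, (a, b) ∈ g.1) ∧ f ≤ g := by
  classical
  by_cases h : ∃ b, (a, b) ∈ f.1
  · exact ⟨f, h, le_rfl⟩
  have hdisj : Disjoint ((f.1.filter fun p => G.Adj a p.1).image Prod.snd)
      ((f.1.filter fun p => ¬ G.Adj a p.1).image Prod.snd) := by
    rw [Finset.disjoint_left]
    intro y hy hy'
    simp only [Finset.mem_image, Finset.mem_filter] at hy hy'
    obtain ⟨p, ⟨hp, hpa⟩, rfl⟩ := hy
    obtain ⟨q, ⟨hq, hqa⟩, hqp⟩ := hy'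
    rw [((f.2 q hq p hp).1).2 hqp] at hqa
    exact hqa hpa
  -- Each old image is either a neighbour of `b`, hence distinct from it, or a member of the set
  -- that `b` avoids; so `b` is new.
  obtain ⟨b, hbB, hbA, hbB'⟩ := hH _ _ hdisj
  have key : ∀ p ∈ f.1, a ≠ p.1 ∧ b ≠ p.2 ∧ (G.Adj a p.1 ↔ H.Adj b p.2) := by
    intro p hp
    refine ⟨fun e => h ⟨p.2, by rw [e]; exact hp⟩, ?_⟩
    by_cases hap : G.Adj a p.1
    · have hb := hbA p.2 (Finset.mem_image_of_mem _ (Finset.mem_filter.2 ⟨hp, hap⟩))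
      exact ⟨hb.ne, by simp [hap, hb]⟩
    · have hm := Finset.mem_image_of_mem Prod.snd
        
        (show p ∈ f.1.filter (fun p => ¬ G.Adj a p.1) from Finset.mem_filter.2 ⟨hp, hap⟩)
      exact ⟨fun e => hbB (e ▸ hm), by simp [hap, hbB' _ hm]⟩
  refine ⟨⟨insert (a, b) f.1, ?_⟩, ⟨b, Finset.mem_insert_self _ _⟩, Finset.subset_insert _ _⟩
  intro p hp q hq
  rw [Finset.mem_insert] at hp hq
  rcases hp with rfl | hp <;> rcases hq with rfl | hq
  · simp
  · obtain ⟨h1, h2, h3⟩ := key q hq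
    exact ⟨by simp [h1, h2], h3⟩
  · obtain ⟨h1, h2, h3⟩ := key p hp
    exact ⟨by simp [h1.symm, h2.symm], by rw [G.adj_comm, H.adj_comm]; exact h3⟩
  · exact f.2 p hp q hq

/-- The inverse of a finite partial isomorphism. -/
def symm (f : FinitePartialIso G H) : FinitePartialIso H G :=
  ⟨f.1.map (Equiv.prodComm V W).toEmbedding, by
    intro p hp q hq
    simp only [Finset.mem_map_equiv] at hp hq
    have := f.2 _ hp _ hq
    exact ⟨this.1.symm, this.2.symm⟩⟩

theorem mem_symm {f : FinitePartialIso G H} {p : W × V} : p ∈ f.symm.1 ↔ (p.2, p.1) ∈ f.1 := by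
  simp [symm, Finset.mem_map_equiv, Prod.swap]

theorem exists_extend_right (hG : G.HasExtensionProperty) (f : FinitePartialIso G H) (b : W) :
    ∃ g : FinitePartialIso G H, (∃ a, (a, b) ∈ g.1) ∧ f ≤ g := by
  obtain ⟨g, ⟨a, ha⟩, hfg⟩ := exists_extend_left hG f.symm b
  refine ⟨g.symm, ⟨a, mem_symm.2 ha⟩, fun p hp => mem_symm.2 (hfg (mem_symm.2 hp))⟩

end FinitePartialIso

-- Back-and-forth: countably many cofinal conditions, one per vertex of either graph, are met by a
-- single ideal of finite partial isomorphisms, whose union is an isomorphism.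
open FinitePartialIso in
theorem HasExtensionProperty.nonempty_iso {V W : Type*} [Countable V] [Countable W]
    {G : SimpleGraph V} {H : SimpleGraph W} (hG : G.HasExtensionProperty)
    (hH : H.HasExtensionProperty) : Nonempty (G ≃g H) := by
  cases nonempty_encodable V
  cases nonempty_encodable W
  let 𝒟 : V ⊕ W → Order.Cofinal (FinitePartialIso G H) := fun x => Sum.recOn x
    (fun a => ⟨{g | ∃ b, (a, b) ∈ g.1}, fun f => exists_extend_left hH f a⟩)
    (fun b => ⟨{g | ∃ a, (a, b) ∈ g.1}, fun f => exists_extend_right hG f b⟩)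
  let I := Order.idealOfCofinals (P := FinitePartialIso G H) ⟨∅, by simp⟩ 𝒟
  have hl : ∀ a : V, ∃ b, ∃ f ∈ I, (a, b) ∈ f.1 := fun a => by
    obtain ⟨f, ⟨b, hb⟩, hf⟩ := Order.cofinal_meets_idealOfCofinals _ 𝒟 (Sum.inl a)
    exact ⟨b, f, hf, hb⟩
  have hr : ∀ b : W, ∃ a, ∃ f ∈ I, (a, b) ∈ f.1 := fun b => by
    obtain ⟨f, ⟨a, ha⟩, hf⟩ := Order.cofinal_meets_idealOfCofinals _ 𝒟 (Sum.inr b)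
    exact ⟨a, f, hf, ha⟩
  have key : ∀ {a b a' b'}, (∃ f ∈ I, (a, b) ∈ f.1) → (∃ f ∈ I, (a', b') ∈ f.1) →
      (a = a' ↔ b = b') ∧ (G.Adj a a' ↔ H.Adj b b') := by
    rintro a b a' b' ⟨f, hf, hab⟩ ⟨g, hg, hab'⟩
    obtain ⟨m, -, fm, gm⟩ := I.directed _ hf _ hg
    exact m.2 _ (fm hab) _ (gm hab')
  choose φ hφ using hl
  choose ψ hψ using hr
  exact ⟨{ toFun := φ
           invFun := ψ
           left_inv := fun a => (key (hψ (φ a)) (hφ a)).1.2 rfl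
           right_inv := fun b => (key (hφ (ψ b)) (hψ b)).1.1 rfl
           map_rel_iff' := fun {a b} => (key (hφ a) (hφ b)).2.symm }⟩

theorem HasExtensionProperty.isAlgebraicallyClosed {V : Type*} {G : SimpleGraph V}
    (hG : G.HasExtensionProperty) : G.IsAlgebraicallyClosed := fun A => by
  obtain ⟨v, -, hv, -⟩ := hG A ∅ (by simp)
  exact ⟨v, hv⟩

theorem IsAlgebraicallyClosed.infinite {V : Type*} {G : SimpleGraph V}
    (hG : G.IsAlgebraicallyClosed) : Infinite V := by
  by_contra h
  rw [not_infinite_iff_finite] at h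
  cases nonempty_fintype V
  obtain ⟨v, hv⟩ := hG Finset.univ
  exact (hv v (Finset.mem_univ v)).ne rfl

/-! ### Countable graphs inside the random graph -/

/-- The graph on `V ⊕ ℕ` that extends `G` and in which the vertex `n : ℕ` is joined to those
members of the finite set `F n` that lie in `V` or precede `n`. -/
def extendByFinsets {V : Type*} (G : SimpleGraph V) (F : ℕ → Finset (V ⊕ ℕ)) :
    SimpleGraph (V ⊕ ℕ) where
  Adj
    | Sum.inl u, Sum.inl v => G.Adj u v
    | Sum.inl u, Sum.inr n => Sum.inl u ∈ F n
    | Sum.inr n, Sum.inl u => Sum.inl u ∈ F n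
    | Sum.inr m, Sum.inr n => (m < n ∧ Sum.inr m ∈ F n) ∨ (n < m ∧ Sum.inr n ∈ F m)
  symm := ⟨by
    rintro (u | m) (v | n) h
    · exact SimpleGraph.Adj.symm h
    · exact h
    · exact h
    · exact Or.symm h⟩
  loopless := ⟨by
    rintro (u | m) h
    · exact G.loopless.irrefl u h
    · simp at h⟩

/-- Beyond all numbers occurring in `A ∪ B` there is some `n` with `F n = A`; within `A ∪ B`, its
neighbours are exactly the members of `A`. -/
theorem extendByFinsets_hasExtensionProperty {V : Type*} (G : SimpleGraph V)
    {F : ℕ → Finset (V ⊕ ℕ)} (hF : ∀ (A : Finset (V ⊕ ℕ)) (N : ℕ), ∃ n, N ≤ n ∧ F n = A) :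
    (G.extendByFinsets F).HasExtensionProperty := by
  classical
  intro A B hAB
  obtain ⟨N, hN⟩ : ∃ N : ℕ, ∀ x ∈ A ∪ B, ∀ m, x = Sum.inr m → m < N := by
    refine ⟨((A ∪ B).sup (Sum.elim (fun _ => 0) id)) + 1, fun x hx m hm => ?_⟩
    have := Finset.le_sup (f := Sum.elim (fun _ : V => 0) (id : ℕ → ℕ)) hx
    subst hm
    simpa [Nat.lt_succ_iff] using this
  obtain ⟨n, hn, rfl⟩ := hF A N
  refine ⟨Sum.inr n, fun h => ?_, fun a ha => ?_, fun b hb h => ?_⟩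
  · have := hN _ (Finset.mem_union_right _ h) n rfl
    omega
  · rcases a with u | m
    · exact ha
    · exact Or.inr ⟨(hN _ (Finset.mem_union_left _ ha) m rfl).trans_le hn, ha⟩
  · have hb' := Finset.disjoint_right.1 hAB hb
    rcases b with u | m
    · exact hb' h
    · have := hN _ (Finset.mem_union_right _ hb) m rfl
      rcases h with ⟨h, -⟩ | ⟨-, h⟩
      · omega
      · exact hb' h

open Classical in
/-- The extension of a map `p` to `V ⊕ ℕ`, sending `n : ℕ` to the vertex chosen by `c` for the
image of the part of `F n` that lies in `V` or precedes `n`. -/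
noncomputable def extendMap {V Δ : Type*} (F : ℕ → Finset (V ⊕ ℕ)) (p : V → Δ)
    (c : Finset Δ → Δ) : ℕ → Δ
  | n => c (((F n).attach.image fun x => match x.1 with
      | Sum.inl u => p u
      -- The value `c ∅` is a dummy for members of `F n` that do not precede `n`; it only adds a
      -- harmless constraint on the chosen vertex.
      | Sum.inr m => if m < n then extendMap F p c m else c ∅))

/-- Edges must be preserved but not reflected, so each new vertex may go to any common neighbour of
the images of its earlier neighbours. -/
theorem exists_extendByFinsets_hom {V Δ : Type*} (G : SimpleGraph V) (D : SimpleGraph Δ)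
    (hD : D.IsAlgebraicallyClosed) (F : ℕ → Finset (V ⊕ ℕ)) (p : G →g D) :
    ∃ r : G.extendByFinsets F →g D, ∀ v, r (Sum.inl v) = p v := by
  classical
  choose c hc using hD
  have hinl : ∀ n u, Sum.inl u ∈ F n → D.Adj (extendMap F p c n) (p u) := by
    intro n u hu
    rw [extendMap]
    exact hc _ _ (Finset.mem_image.2 ⟨⟨_, hu⟩, Finset.mem_attach _ _, rfl⟩)
  have hinr : ∀ n m, m < n → Sum.inr m ∈ F n →
      D.Adj (extendMap F p c n) (extendMap F p c m) := by
    intro n m hmn hm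
    rw [extendMap]
    exact hc _ _ (Finset.mem_image.2 ⟨⟨_, hm⟩, Finset.mem_attach _ _, by simp [hmn]⟩)
  refine ⟨⟨Sum.elim p (extendMap F p c), ?_⟩, fun v => rfl⟩
  rintro (u | m) (v | n) h
  · exact p.map_rel h
  · exact (hinl n u h).symm
  · exact hinl m v h
  · rcases h with ⟨h, h'⟩ | ⟨h, h'⟩
    · exact (hinr n m h h').symm
    · exact hinr m n h h'

theorem exists_frequently_surjective (α : Type*) [Countable α] [Nonempty α] :
    ∃ F : ℕ → α, ∀ (a : α) (N : ℕ), ∃ n, N ≤ n ∧ F n = a := by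
  obtain ⟨f, hf⟩ := exists_surjective_nat α
  refine ⟨fun n => f n.unpair.2, fun a N => ?_⟩
  obtain ⟨k, rfl⟩ := hf a
  exact ⟨Nat.pair N k, Nat.left_le_pair _ _, by simp⟩

/-- A homomorphism from a countable graph to an algebraically closed graph factors through an
embedding into any countable graph with the extension property. -/
theorem IsAlgebraicallyClosed.exists_hom_factor {V W Δ : Type*} [Countable V] [Countable W]
    {G : SimpleGraph V} {R : SimpleGraph W} {D : SimpleGraph Δ} (hD : D.IsAlgebraicallyClosed)
    (hR : R.HasExtensionProperty) (p : G →g D) :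
    ∃ (i : G ↪g R) (r : R →g D), ∀ v, r (i v) = p v := by
  obtain ⟨F, hF⟩ := exists_frequently_surjective (Finset (V ⊕ ℕ))
  obtain ⟨r, hr⟩ := exists_extendByFinsets_hom G D hD F p
  obtain ⟨θ⟩ := (extendByFinsets_hasExtensionProperty G hF).nonempty_iso hR
  let j : G ↪g G.extendByFinsets F := ⟨⟨Sum.inl, Sum.inl_injective⟩, Iff.rfl⟩
  refine ⟨θ.toEmbedding.comp j, r.comp θ.symm.toHom, fun v => ?_⟩
  change r (θ.symm (θ (Sum.inl v))) = p v
  rw [θ.symm_apply_apply, hr]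

end SimpleGraph

-- Universality realises the desired one-point extension of `A ∪ B` somewhere in `R`; homogeneity
-- then moves its copy of `A ∪ B` back onto `A ∪ B`, and the extra point with it.
open SimpleGraph in
theorem IsCountableUniversalGraph.hasExtensionProperty {W : Type*} {R : SimpleGraph W}
    (hR : IsCountableUniversalGraph R) : R.HasExtensionProperty := by
  classical
  intro A B hAB
  let U : Finset W := A ∪ B
  let F : SimpleGraph (Option U) :=
    { Adj := fun x y => match x, y with
        | none, none => False
        | none, some y => (y : W) ∈ A
        | some x, none => (x : W) ∈ A
        | some x, some y => R.Adj x y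
      symm := ⟨by
        rintro (_ | x) (_ | y) h
        · exact h
        · exact h
        · exact h
        · exact h.symm⟩
      loopless := ⟨by
        rintro (_ | x) h
        · exact h
        · exact R.loopless.irrefl _ h⟩ }
  let e := Fintype.equivFin (Option U)
  obtain ⟨f⟩ := hR.universal _ (F.map e.toEmbedding)
  let g : F ↪g R := f.comp (SimpleGraph.Iso.map e F).toEmbedding
  let φ₀ : R.induce (U : Set W) ↪g R :=
    g.comp ⟨⟨fun x => some ⟨x.1, x.2⟩, fun x y h =>
      Subtype.ext (congrArg Subtype.val (Option.some.inj h))⟩, by intro x y; exact Iff.rfl⟩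
  obtain ⟨α, hα⟩ := hR.homogeneous (U : Set W) U.finite_toSet φ₀
  have key : ∀ u (hu : u ∈ U), α.symm (g (some ⟨u, hu⟩)) = u := fun u hu => by
    rw [RelIso.symm_apply_eq]
    exact (hα ⟨u, hu⟩).symm
  have hadj : ∀ u (hu : u ∈ U), R.Adj (α.symm (g none)) u ↔ u ∈ A := fun u hu => by
    conv_lhs => rw [← key u hu]
    rw [α.symm.map_adj_iff, g.map_adj_iff]
  refine ⟨α.symm (g none), fun h => ?_, fun a ha => (hadj a (Finset.mem_union_left _ ha)).2 ha,
    fun b hb h => ?_⟩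
  · have hu := Finset.mem_union_right A h
    have := key _ hu
    have := g.injective (α.symm.injective this)
    simp at this
  · exact Finset.disjoint_right.1 hAB hb ((hadj b (Finset.mem_union_right _ hb)).1 h)

/-! ### Green's relations in a monoid -/

namespace Green

variable {M : Type*} [Monoid M]

theorem relL_iff {a b : M} : RelL a b ↔ (∃ m, m * b = a) ∧ ∃ m, m * a = b := by
  constructor
  · intro h
    rw [RelL] at h
    have ha : a ∈ Set.range fun m : M => m * a := ⟨1, one_mul a⟩
    have hb : b ∈ Set.range fun m : M => m * b := ⟨1, one_mul b⟩
    rw [h] at ha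
    rw [← h] at hb
    exact ⟨ha, hb⟩
  · rintro ⟨⟨m, rfl⟩, n, hn⟩
    ext x
    constructor
    · rintro ⟨k, rfl⟩
      exact ⟨k * m, mul_assoc _ _ _⟩
    · rintro ⟨k, rfl⟩
      exact ⟨k * n, by simp only [mul_assoc, hn]⟩

theorem relR_iff {a b : M} : RelR a b ↔ (∃ m, b * m = a) ∧ ∃ m, a * m = b := by
  constructor
  · intro h
    rw [RelR] at h
    have ha : a ∈ Set.range fun m : M => a * m := ⟨1, mul_one a⟩
    have hb : b ∈ Set.range fun m : M => b * m := ⟨1, mul_one b⟩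
    rw [h] at ha
    rw [← h] at hb
    exact ⟨ha, hb⟩
  · rintro ⟨⟨m, rfl⟩, n, hn⟩
    ext x
    constructor
    · rintro ⟨k, rfl⟩
      exact ⟨m * k, (mul_assoc _ _ _).symm⟩
    · rintro ⟨k, rfl⟩
      exact ⟨n * k, by simp only [← mul_assoc, hn]⟩

theorem RelL.symm {a b : M} (h : RelL a b) : RelL b a := Eq.symm h

theorem RelL.trans {a b c : M} (h : RelL a b) (h' : RelL b c) : RelL a c := Eq.trans h h'

theorem RelR.symm {a b : M} (h : RelR a b) : RelR b a := Eq.symm h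

theorem RelR.trans {a b c : M} (h : RelR a b) (h' : RelR b c) : RelR a c := Eq.trans h h'

theorem RelH.refl (a : M) : RelH a a := ⟨rfl, rfl⟩

theorem RelH.symm {a b : M} (h : RelH a b) : RelH b a := ⟨h.1.symm, h.2.symm⟩

theorem RelH.trans {a b c : M} (h : RelH a b) (h' : RelH b c) : RelH a c :=
  ⟨h.1.trans h'.1, h.2.trans h'.2⟩

theorem RelH.relD {a b : M} (h : RelH a b) : RelD a b := ⟨b, h.1, rfl⟩

/-- L and R commute because one acts by left and the other by right multiplication; this makes D
symmetric and transitive. -/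
theorem exists_relR_relL {a b c : M} (h : RelL a c) (h' : RelR c b) :
    ∃ d, RelR a d ∧ RelL d b := by
  obtain ⟨⟨n, hn⟩, m, hm⟩ := relL_iff.1 h
  obtain ⟨⟨k, hk⟩, l, hl⟩ := relR_iff.1 h'
  refine ⟨a * l, relR_iff.2 ⟨⟨k, ?_⟩, l, rfl⟩, relL_iff.2 ⟨⟨n, ?_⟩, m, ?_⟩⟩
  · rw [← hn, mul_assoc n, hl, mul_assoc, hk]
  · rw [← hl, ← mul_assoc, hn]
  · rw [← mul_assoc, hm, hl]

theorem RelD.symm {a b : M} (h : RelD a b) : RelD b a := by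
  obtain ⟨c, hac, hcb⟩ := h
  obtain ⟨d, had, hdb⟩ := exists_relR_relL hac hcb
  exact ⟨d, hdb.symm, had.symm⟩

theorem RelD.trans {a b c : M} (h : RelD a b) (h' : RelD b c) : RelD a c := by
  obtain ⟨x, hax, hxb⟩ := h
  obtain ⟨y, hby, hyc⟩ := h'
  obtain ⟨z, hzy, hxz⟩ : ∃ z, RelR z y ∧ RelL x z := by
    obtain ⟨z, hyz, hzx⟩ := exists_relR_relL hby.symm hxb.symm
    exact ⟨z, hyz.symm, hzx.symm⟩
  exact ⟨z, hax.trans hxz, hzy.trans hyc⟩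

theorem setOf_relD_eq {a b : M} (h : RelD a b) : {x | RelD a x} = {x | RelD b x} :=
  Set.ext fun _ => ⟨fun hx => h.symm.trans hx, fun hx => h.trans hx⟩

theorem RelL.mul_eq_of_isIdempotentElem {e a : M} (he : IsIdempotentElem e) (h : RelL e a) :
    a * e = a := by
  obtain ⟨-, m, rfl⟩ := relL_iff.1 h
  rw [mul_assoc, he]

theorem RelR.mul_eq_of_isIdempotentElem {e a : M} (he : IsIdempotentElem e) (h : RelR e a) :
    e * a = a := by
  obtain ⟨-, m, rfl⟩ := relR_iff.1 h
  rw [← mul_assoc, he]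

theorem RelH.eq_of_isIdempotentElem {e f : M} (he : IsIdempotentElem e)
    (hf : IsIdempotentElem f) (h : RelH e f) : e = f :=
  (h.symm.1.mul_eq_of_isIdempotentElem hf).symm.trans (h.2.mul_eq_of_isIdempotentElem he)

/-- With `relD_of_inverse`, this replaces D-relatedness of idempotents by a pair of mutually inverse
maps between their images. -/
theorem exists_inverse_of_relD {e f : M} (he : IsIdempotentElem e) (hf : IsIdempotentElem f)
    (h : RelD e f) : ∃ a b, a * b = e ∧ b * a = f := by
  obtain ⟨c, hec, hcf⟩ := h
  have hce := hec.mul_eq_of_isIdempotentElem he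
  have hfc := hcf.symm.mul_eq_of_isIdempotentElem hf
  obtain ⟨⟨n, hn⟩, -⟩ := relL_iff.1 hec
  obtain ⟨-, l, hl⟩ := relR_iff.1 hcf
  refine ⟨n * f, c, ?_, ?_⟩
  · rw [mul_assoc, hfc, hn]
  · rw [← hl, ← mul_assoc n, hn, ← mul_assoc, hce]

theorem relD_of_inverse {a b : M} (hb : b * a * b = b) :
    RelD (a * b) (b * a) :=
  ⟨b, relL_iff.2 ⟨⟨a, rfl⟩, b, by rw [← mul_assoc, hb]⟩,
    relR_iff.2 ⟨⟨b, hb⟩, a, rfl⟩⟩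

theorem exists_inverse_of_relH {e a : M} (he : IsIdempotentElem e) (h : RelH e a) :
    ∃ b, a * b = e ∧ b * a = e := by
  have hae := h.1.mul_eq_of_isIdempotentElem he
  have hea := h.2.mul_eq_of_isIdempotentElem he
  obtain ⟨⟨n, hn⟩, -⟩ := relL_iff.1 h.1
  obtain ⟨⟨l, hl⟩, -⟩ := relR_iff.1 h.2
  refine ⟨n * e, ?_, by rw [mul_assoc, hea, hn]⟩
  calc a * (n * e) = a * (n * a) * l := by rw [← hl]; simp only [mul_assoc]
    _ = e := by rw [hn, hae, hl]

theorem IsRegularElement.exists_idempotent {a : M} (h : IsRegularElement a) :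
    ∃ e, IsIdempotentElem e ∧ RelD a e := by
  obtain ⟨b, hb⟩ := h
  refine ⟨b * a, ?_, b * a, relL_iff.2 ⟨⟨a, by rw [← mul_assoc, hb]⟩, b, rfl⟩, rfl⟩
  rw [IsIdempotentElem, mul_assoc, ← mul_assoc a, hb]

theorem isRegularDClass_iff {D : Set M} :
    IsRegularDClass D ↔ ∃ e, IsIdempotentElem e ∧ D = {b | RelD e b} := by
  constructor
  · rintro ⟨a, ha, rfl⟩
    obtain ⟨e, he, hae⟩ := ha.exists_idempotent
    exact ⟨e, he, setOf_relD_eq hae⟩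
  · rintro ⟨e, he, rfl⟩
    exact ⟨e, ⟨e, by rw [he, he]⟩, rfl⟩

theorem IsGroupHClass.exists_idempotent {H : Set M} (h : IsGroupHClass H) :
    ∃ e, IsIdempotentElem e ∧ H = {b | RelH e b} := by
  obtain ⟨⟨a, rfl⟩, S, hS, e, he, -⟩ := h
  have hae : RelH a e := by
    have := e.2
    rw [← SetLike.mem_coe, hS] at this
    exact this
  exact ⟨e, congrArg Subtype.val (he e).1,
    Set.ext fun _ => ⟨fun hx => hae.symm.trans hx, fun hx => hae.trans hx⟩⟩

/-- If an injective multiplicative map from a group `G` sends `1` to `e` and has the `H`-class of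
`e` as its range, then this `H`-class is a group `H`-class isomorphic to `G`. -/
theorem isGroupHClass_of_mulHom {G : Type*} [Group G] (ψ : G →ₙ* M) (hψ : Function.Injective ψ)
    (hr : Set.range ψ = {b | RelH (ψ 1) b}) :
    IsGroupHClass {b | RelH (ψ 1) b} ∧ IsIsomorphicTo {b | RelH (ψ 1) b} G := by
  have hS : (ψ.srange : Set M) = {b | RelH (ψ 1) b} := by rw [MulHom.coe_srange, hr]
  refine ⟨⟨⟨_, rfl⟩, ψ.srange, hS, ⟨ψ 1, 1, rfl⟩, ?_, ?_⟩, ψ.srange, hS, ⟨?_⟩⟩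
  · rintro ⟨_, g, rfl⟩
    exact ⟨Subtype.ext (by simp [← map_mul]), Subtype.ext (by simp [← map_mul])⟩
  · rintro ⟨_, g, rfl⟩
    exact ⟨⟨ψ g⁻¹, g⁻¹, rfl⟩, Subtype.ext (by simp [← map_mul]),
      Subtype.ext (by simp [← map_mul])⟩
  · refine (MulEquiv.ofBijective ψ.srangeRestrict ⟨fun x y h => hψ ?_, ?_⟩).symm
    · exact congrArg Subtype.val h
    · exact ψ.srangeRestrict_surjective

theorem IsIsomorphicTo.congr {H : Set M} {G G' : Type*} [Group G] [Group G']
    (h : IsIsomorphicTo H G) (e : G ≃* G') : IsIsomorphicTo H G' := by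
  obtain ⟨S, hS, ⟨f⟩⟩ := h
  exact ⟨S, hS, ⟨f.trans e⟩⟩

end Green

/-! ### Idempotent endomorphisms as retractions -/

namespace SimpleGraph

variable {W Δ Δ' : Type*} {R : SimpleGraph W} {D : SimpleGraph Δ} {D' : SimpleGraph Δ'}

/-- The endomorphism `s ∘ r`. -/
def Hom.retract (r : R →g D) (s : D →g R) : R →g R := s.comp r

theorem isIdempotentElem_retract {r : R →g D} {s : D →g R} (h : ∀ x, r (s x) = x) :
    IsIdempotentElem (Hom.retract r s) := by
  ext w
  exact congrArg s (h (r w))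

theorem exists_retract {e : R →g R} (he : IsIdempotentElem e) :
    ∃ (r : R →g R.induce (Set.range e)) (s : R.induce (Set.range e) →g R),
      (∀ x, r (s x) = x) ∧ e = Hom.retract r s := by
  refine ⟨⟨fun w => ⟨e w, w, rfl⟩, fun h => e.map_rel h⟩, ⟨Subtype.val, id⟩, ?_, rfl⟩
  rintro ⟨_, w, rfl⟩
  exact Subtype.ext (DFunLike.congr_fun he w)

theorem IsAlgebraicallyClosed.of_retract (hR : R.IsAlgebraicallyClosed) {r : R →g D} {s : D →g R}
    (h : ∀ x, r (s x) = x) : D.IsAlgebraicallyClosed := by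
  classical
  intro A
  obtain ⟨w, hw⟩ := hR (A.image s)
  refine ⟨r w, fun a ha => ?_⟩
  have := r.map_rel (hw _ (Finset.mem_image_of_mem s ha))
  rwa [h] at this

/-- The factors `a` and `b` of the two idempotents restrict to mutually inverse homomorphisms
between the retracts. -/
theorem nonempty_iso_of_relD {r : R →g D} {s : D →g R} {r' : R →g D'} {s' : D' →g R}
    (h : ∀ x, r (s x) = x) (h' : ∀ x, r' (s' x) = x)
    (hD : Green.RelD (Hom.retract r s) (Hom.retract r' s')) : Nonempty (D ≃g D') := by
  obtain ⟨a, b, hab, hba⟩ := Green.exists_inverse_of_relD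
    (isIdempotentElem_retract h) (isIdempotentElem_retract h') hD
  have hab' : ∀ w, a (b w) = s (r w) := DFunLike.congr_fun hab
  have hba' : ∀ w, b (a w) = s' (r' w) := DFunLike.congr_fun hba
  have h1 : ∀ x, r (a (s' (r' (b (s x))))) = x := fun x => by
    rw [← hba', hab', hab', h, h, h]
  have h2 : ∀ x, r' (b (s (r (a (s' x))))) = x := fun x => by
    rw [← hab', hba', hba', h', h', h']
  refine ⟨⟨⟨fun x => r' (b (s x)), fun x => r (a (s' x)), h1, h2⟩, fun {x y} => ⟨fun hxy => ?_,
    fun hxy => r'.map_rel (b.map_rel (s.map_rel hxy))⟩⟩⟩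
  have := r.map_rel (a.map_rel (s'.map_rel hxy))
  change D.Adj (r (a (s' (r' (b (s x)))))) (r (a (s' (r' (b (s y)))))) at this
  rwa [h1, h1] at this

theorem relD_of_iso {r : R →g D} {s : D →g R} {r' : R →g D'} {s' : D' →g R}
    (h : ∀ x, r (s x) = x) (h' : ∀ x, r' (s' x) = x) (φ : D ≃g D') :
    Green.RelD (Hom.retract r s) (Hom.retract r' s') := by
  let a : R →g R := s.comp (φ.symm.toHom.comp r')
  let b : R →g R := s'.comp (φ.toHom.comp r)
  have hab : a * b = Hom.retract r s := by
    ext w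
    change s (φ.symm (r' (s' (φ (r w))))) = s (r w)
    rw [h', φ.symm_apply_apply]
  have hba : b * a = Hom.retract r' s' := by
    ext w
    change s' (φ (r (s (φ.symm (r' w))))) = s' (r' w)
    rw [h, φ.apply_symm_apply]
  rw [← hab, ← hba]
  refine Green.relD_of_inverse ?_
  rw [hba]
  ext w
  change s' (r' (s' _)) = s' _
  rw [h']

/-- The transport of automorphisms of a retract to endomorphisms of the whole graph. -/
def retractMulHom {r : R →g D} {s : D →g R} (h : ∀ x, r (s x) = x) : (D ≃g D) →ₙ* (R →g R) where
  toFun φ := s.comp (φ.toHom.comp r)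
  map_mul' φ ψ := by
    ext w
    change s (φ (ψ (r w))) = s (φ (r (s (ψ (r w)))))
    rw [h]

/-- An element `b` of the class satisfies `e * b = b = b * e`, so it is determined by `r ∘ b ∘ s`;
its inverse relative to `e` makes this an automorphism of `D`. -/
theorem relH_retract {r : R →g D} {s : D →g R} (h : ∀ x, r (s x) = x) :
    Green.IsGroupHClass {b | Green.RelH (Hom.retract r s) b} ∧
      Green.IsIsomorphicTo {b | Green.RelH (Hom.retract r s) b} (D ≃g D) := by
  refine Green.isGroupHClass_of_mulHom (retractMulHom h) (fun φ ψ hφ => ?_) ?_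
  · ext x
    have := congrArg r (DFunLike.congr_fun hφ (s x))
    change r (s (φ (r (s x)))) = r (s (ψ (r (s x)))) at this
    simpa only [h] using this
  · change _ = {b | Green.RelH (Hom.retract r s) b}
    ext b
    constructor
    · rintro ⟨φ, rfl⟩
      have h1 : retractMulHom h φ⁻¹ * retractMulHom h φ = Hom.retract r s := by
        rw [← map_mul, inv_mul_cancel]; rfl
      have h2 : retractMulHom h φ * retractMulHom h φ⁻¹ = Hom.retract r s := by
        rw [← map_mul, mul_inv_cancel]; rfl
      have h3 : retractMulHom h φ * Hom.retract r s = retractMulHom h φ := by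
        change _ * retractMulHom h 1 = _
        rw [← map_mul, mul_one]
      have h4 : Hom.retract r s * retractMulHom h φ = retractMulHom h φ := by
        change retractMulHom h 1 * _ = _
        rw [← map_mul, one_mul]
      exact ⟨Green.relL_iff.2 ⟨⟨_, h1⟩, _, h3⟩, Green.relR_iff.2 ⟨⟨_, h2⟩, _, h4⟩⟩
    · intro hb
      have he := isIdempotentElem_retract h
      have hbe : ∀ w, b (s (r w)) = b w :=
        DFunLike.congr_fun (hb.1.mul_eq_of_isIdempotentElem he)
      have heb : ∀ w, s (r (b w)) = b w :=
        DFunLike.congr_fun (hb.2.mul_eq_of_isIdempotentElem he)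
      obtain ⟨c, hbc, hcb⟩ := Green.exists_inverse_of_relH he hb
      have hbc' : ∀ w, b (c w) = s (r w) := DFunLike.congr_fun hbc
      have hcb' : ∀ w, c (b w) = s (r w) := DFunLike.congr_fun hcb
      have h1 : ∀ x, r (c (s (r (b (s x))))) = x := fun x => by rw [heb, hcb', h, h]
      have h2 : ∀ x, r (b (s (r (c (s x))))) = x := fun x => by rw [hbe, hbc', h, h]
      refine ⟨⟨⟨fun x => r (b (s x)), fun x => r (c (s x)), h1, h2⟩, fun {x y} =>
        ⟨fun hxy => ?_, fun hxy => r.map_rel (b.map_rel (s.map_rel hxy))⟩⟩, ?_⟩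
      · have := r.map_rel (c.map_rel (s.map_rel hxy))
        change D.Adj (r (c (s (r (b (s x)))))) (r (c (s (r (b (s y)))))) at this
        rwa [h1, h1] at this
      · ext w
        change s (r (b (s (r w)))) = b w
        rw [heb, hbe]

end SimpleGraph

/-! ### Rigid graphs coding sets of natural numbers -/

namespace SimpleGraph

/-- The half graph, with `inl i` joined to `inr j` for `i ≤ j`, to which an edge from `inl i` to
`inl (i + 1)` is added for each `i ∈ S`. -/
def codedHalfGraph (S : Set ℕ) : SimpleGraph (ℕ ⊕ ℕ) where
  Adj
    | Sum.inl i, Sum.inl j => (i ∈ S ∧ j = i + 1) ∨ (j ∈ S ∧ i = j + 1)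
    | Sum.inl i, Sum.inr j => i ≤ j
    | Sum.inr j, Sum.inl i => i ≤ j
    | Sum.inr _, Sum.inr _ => False
  symm := ⟨by
    rintro (i | i) (j | j) h
    · exact Or.symm h
    · exact h
    · exact h
    · exact h⟩
  loopless := ⟨by
    rintro (i | i) h
    · rcases h with ⟨-, h⟩ | ⟨-, h⟩ <;> omega
    · exact h⟩

namespace codedHalfGraph

variable {S S' : Set ℕ}

theorem connected (S : Set ℕ) : (codedHalfGraph S).Preconnected := by
  have h1 : ∀ j, (codedHalfGraph S).Reachable (Sum.inr j) (Sum.inl 0) := fun j =>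
    Adj.reachable (Nat.zero_le j)
  have h2 : ∀ x, (codedHalfGraph S).Reachable x (Sum.inl 0) := by
    rintro (i | j)
    · exact (Adj.reachable (show (codedHalfGraph S).Adj (Sum.inl i) (Sum.inr i) from
        le_refl i)).trans (h1 i)
    · exact h1 j
  exact fun x y => (h2 x).trans (h2 y).symm

theorem neighborSet_inr (S : Set ℕ) (j : ℕ) :
    (codedHalfGraph S).neighborSet (Sum.inr j) = Sum.inl '' Set.Iic j := by
  ext (i | i)
  · simp [codedHalfGraph]
  · simp [codedHalfGraph]

theorem infinite_neighborSet_inl (S : Set ℕ) (i : ℕ) :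
    ((codedHalfGraph S).neighborSet (Sum.inl i)).Infinite := by
  refine ((Set.Ici_infinite i).image Sum.inr_injective.injOn).mono ?_
  rintro _ ⟨j, hj, rfl⟩
  exact hj

theorem encard_neighborSet_inr (S : Set ℕ) (j : ℕ) :
    ((codedHalfGraph S).neighborSet (Sum.inr j)).encard = j + 1 := by
  rw [neighborSet_inr, Sum.inl_injective.encard_image, ← Finset.coe_Iic,
    Set.encard_coe_eq_coe_finsetCard]
  simp

theorem encard_neighborSet_iso {V V' : Type*} {G : SimpleGraph V} {G' : SimpleGraph V'}
    (σ : G ≃g G') (v : V) : (G'.neighborSet (σ v)).encard = (G.neighborSet v).encard := by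
  rw [← σ.injective.encard_image]
  congr 1
  ext w
  constructor
  · intro h
    refine ⟨σ.symm w, ?_, σ.apply_symm_apply w⟩
    rw [mem_neighborSet, ← σ.map_adj_iff, σ.apply_symm_apply]
    exact h
  · rintro ⟨u, hu, rfl⟩
    exact σ.map_adj_iff.2 hu

/-- Degrees decide: `inr j` has degree `j + 1`, and every `inl i` has infinite degree. -/
theorem iso_inr (σ : codedHalfGraph S ≃g codedHalfGraph S') (j : ℕ) :
    σ (Sum.inr j) = Sum.inr j := by
  have h := encard_neighborSet_iso σ (Sum.inr j)
  rw [encard_neighborSet_inr] at h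
  rcases hx : σ (Sum.inr j) with i | k
  · rw [hx, (infinite_neighborSet_inl S' i).encard_eq] at h
    exact absurd h.symm (by exact_mod_cast ENat.natCast_ne_top (j + 1))
  · rw [hx, encard_neighborSet_inr] at h
    have : k + 1 = j + 1 := by exact_mod_cast h
    rw [Nat.succ_injective this]

/-- The index `i` is the least `j` for which `inl i` is adjacent to the fixed vertex `inr j`. -/
theorem iso_inl (σ : codedHalfGraph S ≃g codedHalfGraph S') (i : ℕ) :
    σ (Sum.inl i) = Sum.inl i := by
  rcases hx : σ (Sum.inl i) with k | k
  · have key : ∀ j, k ≤ j ↔ i ≤ j := fun j => by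
      have := σ.map_adj_iff (v := Sum.inl i) (w := Sum.inr j)
      rw [hx, iso_inr] at this
      exact this
    rw [le_antisymm ((key i).2 le_rfl) ((key k).1 le_rfl)]
  · rw [← iso_inr σ k] at hx
    simpa using σ.injective hx

theorem iso_apply (σ : codedHalfGraph S ≃g codedHalfGraph S') (x : ℕ ⊕ ℕ) : σ x = x := by
  rcases x with i | j
  · exact iso_inl σ i
  · exact iso_inr σ j

theorem mem_iff (S : Set ℕ) (i : ℕ) :
    i ∈ S ↔ (codedHalfGraph S).Adj (Sum.inl i) (Sum.inl (i + 1)) := by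
  simp only [codedHalfGraph, and_true]
  exact ⟨Or.inl, fun h => h.elim id fun h => absurd h.2 (by omega)⟩

theorem eq_of_iso (σ : codedHalfGraph S ≃g codedHalfGraph S') : S = S' := by
  ext i
  rw [mem_iff, mem_iff, ← σ.map_adj_iff, iso_apply, iso_apply]

end codedHalfGraph

/-- The range of `f` is a union of connected components. -/
def Embedding.HasClosedRange {V W : Type*} {G : SimpleGraph V} {H : SimpleGraph W}
    (f : G ↪g H) : Prop :=
  ∀ v w, H.Adj (f v) w → w ∈ Set.range f

theorem Embedding.HasClosedRange.mem_range {V W : Type*} {G : SimpleGraph V} {H : SimpleGraph W}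
    {f : G ↪g H} (hf : f.HasClosedRange) {x y : W} (hxy : H.Reachable x y)
    (hx : x ∈ Set.range f) : y ∈ Set.range f := by
  obtain ⟨p⟩ := hxy
  induction p with
  | nil => exact hx
  | cons h _ ih =>
    obtain ⟨v, rfl⟩ := hx
    exact ih (hf _ _ h)

namespace codedHalfGraph

variable {S S' : Set ℕ}

theorem range_subset {V : Type*} {G : SimpleGraph V} (f : codedHalfGraph S ↪g G) {V' : Type*}
    {G' : SimpleGraph V'} {g : G' ↪g G} (hg : g.HasClosedRange) {x : ℕ ⊕ ℕ}
    (hx : f x ∈ Set.range g) (y : ℕ ⊕ ℕ) : f y ∈ Set.range g :=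
  hg.mem_range ((connected S x y).map f.toHom) hx

/-- Two copies of coded half graphs that are components of the same graph and meet are equal. -/
theorem eq_of_closed_embeddings {V : Type*} {G : SimpleGraph V} {f : codedHalfGraph S ↪g G}
    {g : codedHalfGraph S' ↪g G} (hf : f.HasClosedRange) (hg : g.HasClosedRange)
    {x y : ℕ ⊕ ℕ} (hxy : f x = g y) : S = S' ∧ ∀ z, f z = g z := by
  choose φ hφ using range_subset f hg ⟨y, hxy.symm⟩
  choose ψ hψ using range_subset g hf ⟨x, hxy⟩
  let σ : codedHalfGraph S ≃g codedHalfGraph S' :=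
    { toFun := φ
      invFun := ψ
      left_inv := fun z => f.injective (by rw [hψ, hφ])
      right_inv := fun z => g.injective (by rw [hφ, hψ])
      map_rel_iff' := fun {a b} => by
        change (codedHalfGraph S').Adj (φ a) (φ b) ↔ _
        rw [← g.map_adj_iff, hφ, hφ, f.map_adj_iff] }
  refine ⟨eq_of_iso σ, fun z => ?_⟩
  rw [← hφ z]
  exact congrArg g (iso_apply σ z)

end codedHalfGraph

variable {V : Type*}

/-- The sets `S` whose coded half graph is not a connected component of `G`. -/
def admissibleCodes (G : SimpleGraph V) : Set (Set ℕ) :=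
  {S | ∀ f : codedHalfGraph S ↪g G, ¬ f.HasClosedRange}

/-- Components coding different sets are disjoint, so the image of `inl 0` determines the code among
countably many vertices. -/
theorem countable_compl_admissibleCodes [Countable V] (G : SimpleGraph V) :
    (admissibleCodes G)ᶜ.Countable := by
  have : ∀ S : ↥(admissibleCodes G)ᶜ, ∃ f : codedHalfGraph S.1 ↪g G, f.HasClosedRange := by
    rintro ⟨S, hS⟩
    simpa [admissibleCodes] using hS
  choose f hf using this
  have hinj : Function.Injective fun S => f S (Sum.inl 0) := fun S T h =>
    Subtype.ext (codedHalfGraph.eq_of_closed_embeddings (hf S) (hf T) h).1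
  exact Set.countable_coe_iff.1 hinj.countable

theorem mk_admissibleCodes [Countable V] (G : SimpleGraph V) :
    Cardinal.mk (admissibleCodes G) = Cardinal.continuum := by
  have h := Cardinal.mk_compl_of_infinite (admissibleCodes G)ᶜ (by
    rw [Cardinal.mk_set_nat]
    exact (Cardinal.mk_le_aleph0_iff.2 (countable_compl_admissibleCodes G).to_subtype).trans_lt
      Cardinal.aleph0_lt_continuum)
  rwa [compl_compl, Cardinal.mk_set_nat] at h

/-- The coded component is carried to a component. Admissibility keeps it out of `G`, so it is the
other coded component, and rigidity does the rest. -/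
theorem iso_sum_codedHalfGraph_inr {G : SimpleGraph V} {S S' : Set ℕ}
    (hS : S ∈ admissibleCodes G) (σ : G ⊕g codedHalfGraph S ≃g G ⊕g codedHalfGraph S') :
    S = S' ∧ ∀ x, σ (Sum.inr x) = Sum.inr x := by
  have hr : ∀ T : Set ℕ,
      (Embedding.sumInr : codedHalfGraph T ↪g G ⊕g codedHalfGraph T).HasClosedRange := by
    rintro T v (w | w) h
    · simp at h
    · exact ⟨w, rfl⟩
  have hl : (Embedding.sumInl : G ↪g G ⊕g codedHalfGraph S').HasClosedRange := by
    rintro v (w | w) h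
    · exact ⟨w, rfl⟩
    · simp at h
  let f : codedHalfGraph S ↪g G ⊕g codedHalfGraph S' := σ.toEmbedding.comp Embedding.sumInr
  have hf : f.HasClosedRange := by
    intro v w h
    obtain ⟨u, rfl⟩ := σ.surjective w
    obtain ⟨x, rfl⟩ := hr S v u (σ.map_adj_iff.1 h)
    exact ⟨x, rfl⟩
  rcases hx : f (Sum.inl 0) with v | y
  · exfalso
    choose g hg using codedHalfGraph.range_subset f hl ⟨v, hx.symm⟩
    have hg' : ∀ z, Sum.inl (g z) = f z := hg
    have hadj : ∀ a b, G.Adj (g a) (g b) ↔ (codedHalfGraph S).Adj a b := fun a b => by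
      rw [← f.map_adj_iff, ← hg', ← hg', sum_adj_inl]
    refine hS ⟨⟨g, fun a b hab => f.injective ?_⟩, fun {a b} => hadj a b⟩ ?_
    · rw [← hg', ← hg', hab]
    · intro a w h
      have h' : (G ⊕g codedHalfGraph S').Adj (f a) (Sum.inl w) := by
        rw [← hg', sum_adj_inl]
        exact h
      obtain ⟨b, hb⟩ := hf a _ h'
      refine ⟨b, Sum.inl_injective (β := ℕ ⊕ ℕ) ?_⟩
      exact (hg' b).trans hb
  · exact codedHalfGraph.eq_of_closed_embeddings hf (hr S') hx

/-! ### Algebraically closed graphs with prescribed automorphism group -/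

/-- The complement of the disjoint union of `G` and a coded half graph. -/
def rigidExtension (G : SimpleGraph V) (S : Set ℕ) : SimpleGraph (V ⊕ (ℕ ⊕ ℕ)) :=
  (G ⊕g codedHalfGraph S)ᶜ

theorem rigidExtension_isAlgebraicallyClosed (G : SimpleGraph V) (S : Set ℕ) :
    (rigidExtension G S).IsAlgebraicallyClosed := by
  intro A
  -- Exceeding every index by at least 2 rules out both the half-graph edges `N ≤ j` and the coding
  -- edges between consecutive indices.
  let N := A.sup (Sum.elim (fun _ => 0) (Sum.elim id id)) + 2
  have hN : ∀ x ∈ A, Sum.elim (fun _ => 0) (Sum.elim id id) x + 1 < N := fun x hx => by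
    have := Finset.le_sup (f := Sum.elim (fun _ : V => 0) (Sum.elim (id : ℕ → ℕ) id)) hx
    omega
  refine ⟨Sum.inr (Sum.inl N), fun a ha => ?_⟩
  have := hN a ha
  rw [rigidExtension, compl_adj]
  rcases a with v | i | j
  · simp
  · simp only [Sum.elim_inr, Sum.elim_inl, id] at this
    refine ⟨fun h => ?_, fun h => ?_⟩
    · have := Sum.inl_injective (Sum.inr_injective h)
      omega
    · rcases sum_adj_inr.1 h with ⟨-, h⟩ | ⟨-, h⟩ <;> omega
  · simp only [Sum.elim_inr, id] at this
    refine ⟨by simp, fun h => ?_⟩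
    have : N ≤ j := sum_adj_inr.1 h
    omega

/-- An isomorphism between complements as an isomorphism of the graphs themselves. -/
def Iso.ofCompl {V W : Type*} {G : SimpleGraph V} {H : SimpleGraph W} (σ : Gᶜ ≃g Hᶜ) :
    G ≃g H where
  toEquiv := σ.toEquiv
  map_rel_iff' {a b} := by
    have h := σ.map_adj_iff (v := a) (w := b)
    rw [compl_adj, compl_adj, σ.injective.ne_iff] at h
    by_cases hab : a = b
    · subst hab
      simp
    · simpa [hab, not_iff_not] using h

theorem eq_of_rigidExtension_iso {G : SimpleGraph V} {S S' : Set ℕ} (hS : S ∈ admissibleCodes G)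
    (σ : rigidExtension G S ≃g rigidExtension G S') : S = S' :=
  (iso_sum_codedHalfGraph_inr hS σ.ofCompl).1

theorem nonempty_aut_rigidExtension {G : SimpleGraph V} {S : Set ℕ} (hS : S ∈ admissibleCodes G) :
    Nonempty ((rigidExtension G S ≃g rigidExtension G S) ≃* (G ≃g G)) := by
  let ι : (G ≃g G) → (rigidExtension G S ≃g rigidExtension G S) := fun φ =>
    { toEquiv := Equiv.sumCongr φ.toEquiv (Equiv.refl _)
      map_rel_iff' := by
        intro a b
        rw [rigidExtension, compl_adj, compl_adj, (Equiv.injective _).ne_iff]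
        rcases a with a | a <;> rcases b with b | b <;> simp [φ.map_adj_iff] }
  refine ⟨(MulEquiv.ofBijective (MulHom.mk ι ?_) ⟨?_, ?_⟩).symm⟩
  · intro φ ψ
    ext x
    rcases x with x | x <;> rfl
  · intro φ ψ h
    ext x
    exact Sum.inl_injective (DFunLike.congr_fun h (Sum.inl x))
  · intro σ
    have hr : ∀ x, σ (Sum.inr x) = Sum.inr x := (iso_sum_codedHalfGraph_inr hS σ.ofCompl).2
    have hr' : ∀ x, σ.symm (Sum.inr x) = Sum.inr x := fun x => by
      rw [RelIso.symm_apply_eq, hr]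
    have hl : ∀ v, ∃ w, Sum.inl w = σ (Sum.inl v) := fun v => by
      rcases hx : σ (Sum.inl v) with w | x
      · exact ⟨w, rfl⟩
      · rw [← hr x] at hx
        simpa using σ.injective hx
    have hl' : ∀ v, ∃ w, Sum.inl w = σ.symm (Sum.inl v) := fun v => by
      rcases hx : σ.symm (Sum.inl v) with w | x
      · exact ⟨w, rfl⟩
      · rw [← hr' x] at hx
        simpa using σ.symm.injective hx
    choose φ hφ using hl
    choose ψ hψ using hl'
    refine ⟨⟨⟨φ, ψ, fun v => Sum.inl_injective (β := ℕ ⊕ ℕ) ?_,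
      fun v => Sum.inl_injective (β := ℕ ⊕ ℕ) ?_⟩, fun {a b} => ?_⟩, ?_⟩
    · rw [hψ, hφ, σ.symm_apply_apply]
    · rw [hφ, hψ, σ.apply_symm_apply]
    · change G.Adj (φ a) (φ b) ↔ G.Adj a b
      have := σ.ofCompl.map_adj_iff (v := Sum.inl a) (w := Sum.inl b)
      rw [sum_adj_inl] at this
      rw [← this]
      change _ ↔ (G ⊕g codedHalfGraph S).Adj (σ (Sum.inl a)) (σ (Sum.inl b))
      rw [← hφ, ← hφ, sum_adj_inl]
    · ext x
      rcases x with x | x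
      · exact hφ x
      · exact (hr x).symm

end SimpleGraph

/-! ### Counting the classes -/

namespace Cardinal

theorem mk_setOf_le_continuum {M : Type*} (hM : #M ≤ 𝔠) {P : Set M → Prop} {F : M → Set M}
    (h : ∀ X, P X → ∃ m, X = F m) : #{X // P X} ≤ 𝔠 := by
  choose m hm using fun X : {X // P X} => h X.1 X.2
  refine (mk_le_of_injective (f := m) fun X Y hXY => Subtype.ext ?_).trans hM
  rw [hm X, hm Y, hXY]

theorem continuum_le_mk {X Y : Type*} (hX : 𝔠 ≤ #X) {f : X → Y} (hf : Function.Injective f) :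
    𝔠 ≤ #Y := by
  have h := (lift_le.2 hX).trans (lift_mk_le_lift_mk_of_injective hf)
  rwa [lift_continuum, continuum_le_lift] at h

end Cardinal

namespace SimpleGraph

open Cardinal

theorem mk_end_le_continuum {W : Type*} [Countable W] (R : SimpleGraph W) : #(R →g R) ≤ 𝔠 := by
  cases isEmpty_or_nonempty W
  · have : Subsingleton (R →g R) := DFunLike.coe_injective.subsingleton
    exact (le_one_iff_subsingleton.2 this).trans (one_lt_aleph0.trans aleph0_lt_continuum).le
  · refine (mk_le_of_injective (DFunLike.coe_injective (F := R →g R))).trans ?_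
    calc #(W → W) = #W ^ #W := by simp
      _ ≤ ℵ₀ ^ #W := power_le_power_right mk_le_aleph0
      _ ≤ ℵ₀ ^ ℵ₀ := power_le_power_left aleph0_ne_zero mk_le_aleph0
      _ = 𝔠 := aleph0_power_aleph0

/-- Isomorphic graphs have isomorphic automorphism groups. -/
def autCongr {V V' : Type*} {G : SimpleGraph V} {G' : SimpleGraph V'} (φ : G ≃g G') :
    (G ≃g G) ≃* (G' ≃g G') where
  toFun σ := (φ.symm.trans σ).trans φ
  invFun σ := (φ.trans σ).trans φ.symm
  left_inv σ := by ext; simp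
  right_inv σ := by ext; simp
  map_mul' σ τ := by ext; simp

theorem HasExtensionProperty.mk_groupHClasses {W : Type*} [Countable W] {R : SimpleGraph W}
    (hR : R.HasExtensionProperty) {C : Set (R →g R)} (hC : Green.IsRegularDClass C) :
    #{H : Set (R →g R) // Green.IsGroupHClass H ∧ H ⊆ C} = 𝔠 := by
  classical
  refine le_antisymm (mk_setOf_le_continuum (mk_end_le_continuum R)
    (F := fun e => {b | Green.RelH e b}) fun H hH => ?_) ?_
  · obtain ⟨e, -, he⟩ := hH.1.exists_idempotent
    exact ⟨e, he⟩
  obtain ⟨e, he, rfl⟩ := Green.isRegularDClass_iff.1 hC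
  obtain ⟨r₀, s₀, h₀, h₀'⟩ := exists_retract he
  have hD := hR.isAlgebraicallyClosed.of_retract h₀
  let Δ := R.induce (Set.range e)
  -- The comap along `Prod.fst` is `Δ` with every vertex doubled into nonadjacent twins.
  let p : Δ.comap (Prod.fst : Set.range e × Bool → _) →g Δ := ⟨Prod.fst, id⟩
  obtain ⟨i, r, hr⟩ := hD.exists_hom_factor hR p
  -- All these sections share the retraction `r`; the subset `S` selects the twin over each vertex.
  let s : Set (Set.range e) → (Δ →g R) := fun S =>
    i.toHom.comp ⟨fun x => (x, decide (x ∈ S)), id⟩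
  have hs : ∀ S x, r (s S x) = x := fun S x => hr _
  have hX : 𝔠 ≤ #(Set (Set.range e)) := by
    have := hD.infinite
    rw [mk_set]
    exact power_le_power_left two_ne_zero (aleph0_le_mk _)
  refine continuum_le_mk hX (f := fun S => ⟨{b | Green.RelH (Hom.retract r (s S)) b},
    (relH_retract (hs S)).1, fun b hb => ?_⟩) fun S T hST => ?_
  · have h1 : Green.RelD e (Hom.retract r (s S)) :=
      (congrArg (Green.RelD · _) h₀').mpr (relD_of_iso h₀ (hs S) Iso.refl)
    exact h1.trans (Green.RelH.relD hb)
  · have h1 : Hom.retract r (s T) ∈ {b | Green.RelH (Hom.retract r (s S)) b} := by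
      have h2 := congrArg Subtype.val hST
      dsimp only at h2
      rw [h2]
      exact Green.RelH.refl _
    have h2 := Green.RelH.eq_of_isIdempotentElem (isIdempotentElem_retract (hs S))
      (isIdempotentElem_retract (hs T)) h1
    ext x
    have h3 := DFunLike.congr_fun h2 (s S x)
    change s S (r (s S x)) = s T (r (s S x)) at h3
    rw [hs] at h3
    have h4 := congrArg Prod.snd (i.injective h3)
    exact decide_eq_decide.1 h4

theorem HasExtensionProperty.mk_regularDClasses {W : Type*} [Countable W] {R : SimpleGraph W}
    (hR : R.HasExtensionProperty) {V : Type*} [Countable V] (G : SimpleGraph V) :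
    #{C : Set (R →g R) // Green.IsRegularDClass C ∧
      (∃ H : Set (R →g R), Green.IsGroupHClass H ∧ H ⊆ C) ∧
      ∀ H : Set (R →g R), Green.IsGroupHClass H → H ⊆ C →
        Green.IsIsomorphicTo H (G ≃g G)} = 𝔠 := by
  refine le_antisymm (mk_setOf_le_continuum (mk_end_le_continuum R)
    (F := fun e => {b | Green.RelD e b}) fun C hC => ?_) ?_
  · obtain ⟨e, -, he⟩ := hC.1
    exact ⟨e, he⟩
  have hex : ∀ S : Set ℕ, ∃ (i : rigidExtension G S ↪g R) (r : R →g rigidExtension G S),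
      ∀ v, r (i v) = v := fun S =>
    (rigidExtension_isAlgebraicallyClosed G S).exists_hom_factor hR Hom.id
  choose i r hr using hex
  have hr' : ∀ S v, r S ((i S).toHom v) = v := hr
  refine continuum_le_mk (mk_admissibleCodes G).ge
    (f := fun S => ⟨{b | Green.RelD (Hom.retract (r S.1) (i S.1).toHom) b},
      Green.isRegularDClass_iff.2 ⟨_, isIdempotentElem_retract (hr' _), rfl⟩,
      ⟨_, (relH_retract (hr' S.1)).1, fun _ hb => Green.RelH.relD hb⟩, fun H hH hHC => ?_⟩)
      fun S T hST => ?_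
  -- Any group H-class in the D-class comes from an idempotent whose retract is isomorphic to
  -- `rigidExtension G S`.
  · obtain ⟨e, he, rfl⟩ := hH.exists_idempotent
    have hD := hHC (Green.RelH.refl e)
    obtain ⟨r₀, s₀, h₀, h₀'⟩ := exists_retract he
    rw [h₀'] at hD ⊢
    obtain ⟨φ⟩ := nonempty_iso_of_relD (hr' S.1) h₀ hD
    obtain ⟨ψ⟩ := nonempty_aut_rigidExtension S.2
    exact (relH_retract h₀).2.congr ((autCongr φ.symm).trans ψ)
  · have h1 : Hom.retract (r T.1) (i T.1).toHom ∈
        {b | Green.RelD (Hom.retract (r S.1) (i S.1).toHom) b} := by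
      have h2 := congrArg Subtype.val hST
      dsimp only at h2
      rw [h2]
      exact (Green.RelH.refl _).relD
    obtain ⟨φ⟩ := nonempty_iso_of_relD (hr' S.1) (hr' T.1) h1
    exact Subtype.ext (eq_of_rigidExtension_iso S.2 φ)

end SimpleGraph

theorem mainTheorem1 {W : Type*} (R : SimpleGraph W) (hR : IsCountableUniversalGraph R) :
    (∀ (V : Type*) [Countable V] (Γ : SimpleGraph V),
      Cardinal.mk {D : Set (R →g R) // Green.IsRegularDClass D ∧
        (∃ H : Set (R →g R), Green.IsGroupHClass H ∧ H ⊆ D) ∧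
        ∀ H : Set (R →g R), Green.IsGroupHClass H → H ⊆ D →
          Green.IsIsomorphicTo H (Γ ≃g Γ)} = Cardinal.continuum) ∧
    (∀ D : Set (R →g R), Green.IsRegularDClass D →
      Cardinal.mk {H : Set (R →g R) // Green.IsGroupHClass H ∧ H ⊆ D} =
        Cardinal.continuum) := by
  have := hR.countable
  exact ⟨fun _ _ Γ => hR.hasExtensionProperty.mk_regularDClasses Γ,
    fun _ hD => hR.hasExtensionProperty.mk_groupHClasses hD⟩
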